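/- **Setting.** Let $\mathcal B$ denote a closed Euclidean unit ball centred at the origin. Let $\Omega\subseteq\mathbb R^n$, let $K\subseteq\Omega$ and $U\subseteq\mathbb R^m$ be non-empty and compact, and let $C\subseteq K$ be closed. Let $f$ be such that: for every $x\in\Omega$, $f(x,\cdot):U\to\mathbb R^n$ is continuous and $f(x,U)$ is convex; for every $u\in U$, $f(\cdot,u)$ is $l$-Lipschitz on $\Omega$. Put $M=\max_{x\in K,\,u\in U}\|f(x,u)\|$. The *minimal time function* $\mathbb T^*:\mathbb R^n\to[0,+\infty]$ assigns to $x_0$ the infimum of all $t\ge 0$ for which there are a measurable control $u$ with values in $U$ and a solution of $x(s)=x_0+\int_0^s f(x(r),u(r))\,dr$, $s\in[0,t]$, with $x(s)\in K$ for all $s\in[0,t]$ and $x(t)\in C$ (and $+\infty$ if there is no such $t$). Let $\mathcal D(\mathbb T^*)=\{x\in K:\mathbb T^*(x)<+\infty\}$. For $p\in\mathbb N$ let $0<d_p<\varepsilon_p$ with $\varepsilon_p\to0$ and $d_p/\varepsilon_p\to0$, and let $G_p\subseteq\Omega$ be a set (grid) such that every point of $K$ is within distance $d_p$ of a point of $G_p$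 and such that $K_{d_p}=(K+d_p\mathcal B)\cap G_p$ is finite. Put $\rho_p=2d_p+l\varepsilon_p(d_p+M\varepsilon_p)$ and $F_p(x)=(x+\varepsilon_pf(x,U)+\rho_p\mathcal B)\cap K_{d_p}$. Define $\mathbb T^0_p=0$ on $K_{d_p}$, $\mathbb T_p^0=+\infty$ elsewhere, and $$\mathbb T^{k+1}_p(x)=\begin{cases}\varepsilon_p-d_p+\min_{x'\in F_p(x)}\mathbb T^k_p(x') & \text{if }x\in K_{d_p}\setminus\big(C+(M\varepsilon_p+d_p)\mathcal B\big),\\ \mathbb T^k_p(x)&\text{otherwise,}\end{cases}$$ where the minimum over the empty set is $+\infty$. The sequence $(\mathbb T_p^k)_k$ is nondecreasing; let $\mathbb T^\infty_p=\lim_{k\to\infty}\mathbb T_p^k$, the *discrete minimal time function*. For $\varphi:\mathbb R^n\to[0,+\infty]$ let $\mathcal Epi(\varphi)=\{(x,t)\in\mathbb R^n\times\mathbb R: \varphi(x)\le t\}$. A set $S$ is the Kuratowski limit of sets $A_p$ if $S=\{y:\liminf_p \operatorname{dist}(y,A_p)=0\}=\{y:\lim_p\operatorname{dist}(y,A_p)=0\}$,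 with $\operatorname{dist}(y,\emptyset)=+\infty$. **Theorem.** Assume that $\mathcal Epi(\mathbb T^*)$ is the Kuratowski limit of $\mathcal Epi(\mathbb T^\infty_p)$ as $p\to\infty$. Let $\eta_p\ge d_p$ be such that $\eta_p/d_p$ converges to a finite limit in $[1,+\infty)$. Then for every $x\in\mathcal D(\mathbb T^*)$ the minima below exist for every $p$, and $$\mathbb T^*(x)=\lim_{p\to+\infty}\ \min_{x'\in(x+\eta_p\mathcal B)\cap K_{d_p}}\mathbb T^\infty_p(x').$$ -/

import Mathlib

open Set Filter Topology MeasureTheory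
open scoped ENNReal NNReal Pointwise

noncomputable section

/-- Epigraph `{(x, t) | φ x ≤ t}` in `E × ℝ` of an extended-real valued function. -/
def epigraph {E : Type*} (φ : E → ℝ≥0∞) : Set (E × ℝ) :=
  {q | ((φ q.1 : ℝ≥0∞) : EReal) ≤ ((q.2 : ℝ) : EReal)}

/-- Kuratowski upper limit: the points `y` with `liminf_p dist(y, A p) = 0`
(the distance to the empty set is `+∞`). -/
def kuratowskiLimsup {Y : Type*} [PseudoEMetricSpace Y] (A : ℕ → Set Y) : Set Y :=
  {y | liminf (fun p => Metric.infEDist y (A p)) atTop = 0}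

/-- Kuratowski lower limit: the points `y` with `lim_p dist(y, A p) = 0`. -/
def kuratowskiLiminf {Y : Type*} [PseudoEMetricSpace Y] (A : ℕ → Set Y) : Set Y :=
  {y | Tendsto (fun p => Metric.infEDist y (A p)) atTop (𝓝 0)}

/-- `S` is the Kuratowski limit of the sequence of sets `A`. -/
def IsKuratowskiLimit {Y : Type*} [PseudoEMetricSpace Y] (A : ℕ → Set Y) (S : Set Y) : Prop :=
  kuratowskiLiminf A = S ∧ kuratowskiLimsup A = S

section ContinuousTime

variable {n m : ℕ}

/-- `x` is, on `[0, t]`, the (absolutely continuous) solution from `x₀` of `x' = f (x, u)` driven by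
the measurable control `u` with values in `U`. -/
structure IsTrajectory (f : EuclideanSpace ℝ (Fin n) → EuclideanSpace ℝ (Fin m) →
    EuclideanSpace ℝ (Fin n)) (U : Set (EuclideanSpace ℝ (Fin m)))
    (x₀ : EuclideanSpace ℝ (Fin n)) (t : ℝ)
    (x : ℝ → EuclideanSpace ℝ (Fin n)) (u : ℝ → EuclideanSpace ℝ (Fin m)) : Prop where
  measurable_control : Measurable u
  control_mem : ∀ s ∈ Icc 0 t, u s ∈ U
  integrable : IntervalIntegrable (fun s => f (x s) (u s)) volume 0 t
  eq_integral : ∀ s ∈ Icc 0 t, x s = x₀ + ∫ r in (0 : ℝ)..s, f (x r) (u r)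

/-- The target `C` can be reached from `x₀` at time `t ≥ 0` along a trajectory that stays in `K`
on `[0, t]`. -/
def ReachesAt (f : EuclideanSpace ℝ (Fin n) → EuclideanSpace ℝ (Fin m) →
    EuclideanSpace ℝ (Fin n)) (U : Set (EuclideanSpace ℝ (Fin m)))
    (K C : Set (EuclideanSpace ℝ (Fin n))) (x₀ : EuclideanSpace ℝ (Fin n)) (t : ℝ) : Prop :=
  0 ≤ t ∧ ∃ x u, IsTrajectory f U x₀ t x u ∧ x t ∈ C ∧ ∀ s ∈ Icc 0 t, x s ∈ K

/-- The minimal time function: the infimum of the times at which `C` can be reached from `x₀`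
inside `K`; it is `+∞` if there is no such time, in particular for `x₀ ∉ K`. -/
def minimalTime (f : EuclideanSpace ℝ (Fin n) → EuclideanSpace ℝ (Fin m) →
    EuclideanSpace ℝ (Fin n)) (U : Set (EuclideanSpace ℝ (Fin m)))
    (K C : Set (EuclideanSpace ℝ (Fin n))) (x₀ : EuclideanSpace ℝ (Fin n)) : ℝ≥0∞ :=
  ⨅ (t : ℝ) (_ : ReachesAt f U K C x₀ t), ENNReal.ofReal t

end ContinuousTime

section Discrete

variable {n m : ℕ}

/-- The discretization `K_d = (K + d𝓑) ∩ G` of `K` on the grid `G`. -/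
def gridSet (K G : Set (EuclideanSpace ℝ (Fin n))) (d : ℝ) : Set (EuclideanSpace ℝ (Fin n)) :=
  (K + Metric.closedBall 0 d) ∩ G

/-- Perturbation radius `ρ = 2d + lε(d + Mε)`. -/
def perturbRadius (l M ε d : ℝ) : ℝ := 2 * d + l * ε * (d + M * ε)

/-- One-hop neighbours `(x + ε f(x, U) + ρ𝓑) ∩ K_d` of `x`. -/
def oneHop (f : EuclideanSpace ℝ (Fin n) → EuclideanSpace ℝ (Fin m) →
    EuclideanSpace ℝ (Fin n)) (U : Set (EuclideanSpace ℝ (Fin m)))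
    (K G : Set (EuclideanSpace ℝ (Fin n))) (l M ε d : ℝ) (x : EuclideanSpace ℝ (Fin n)) :
    Set (EuclideanSpace ℝ (Fin n)) :=
  ({x} + ε • (f x '' U) + Metric.closedBall 0 (perturbRadius l M ε d)) ∩ gridSet K G d

open Classical in
/-- Value iteration on `K_d`: it starts from `0` on `K_d` (and `+∞` elsewhere), and the Bellman
update is performed at the points of `K_d` outside the terminal set `C + (Mε + d)𝓑`. The minimum
over an empty set of neighbours is `+∞`. -/
def valueIter (f : EuclideanSpace ℝ (Fin n) → EuclideanSpace ℝ (Fin m) →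
    EuclideanSpace ℝ (Fin n)) (U : Set (EuclideanSpace ℝ (Fin m)))
    (K C G : Set (EuclideanSpace ℝ (Fin n))) (l M ε d : ℝ) :
    ℕ → EuclideanSpace ℝ (Fin n) → ℝ≥0∞
  | 0 => fun x => if x ∈ gridSet K G d then 0 else ⊤
  | k + 1 => fun x =>
      if x ∈ gridSet K G d \ (C + Metric.closedBall 0 (M * ε + d)) then
        ENNReal.ofReal (ε - d) +
          ⨅ x' ∈ oneHop f U K G l M ε d x, valueIter f U K C G l M ε d k x'
      else valueIter f U K C G l M ε d k x

/-- The discrete minimal time function, the limit of the nondecreasing sequence of value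
iterates (see `tendsto_valueIter`). -/
def discreteMinimalTime (f : EuclideanSpace ℝ (Fin n) → EuclideanSpace ℝ (Fin m) →
    EuclideanSpace ℝ (Fin n)) (U : Set (EuclideanSpace ℝ (Fin m)))
    (K C G : Set (EuclideanSpace ℝ (Fin n))) (l M ε d : ℝ)
    (x : EuclideanSpace ℝ (Fin n)) : ℝ≥0∞ :=
  ⨆ k : ℕ, valueIter f U K C G l M ε d k x

theorem valueIter_le_succ (f : EuclideanSpace ℝ (Fin n) → EuclideanSpace ℝ (Fin m) →
    EuclideanSpace ℝ (Fin n)) (U : Set (EuclideanSpace ℝ (Fin m)))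
    (K C G : Set (EuclideanSpace ℝ (Fin n))) (l M ε d : ℝ) (k : ℕ) :
    ∀ x, valueIter f U K C G l M ε d k x ≤ valueIter f U K C G l M ε d (k + 1) x := by
  induction k with
  | zero =>
    intro x
    by_cases h : x ∈ gridSet K G d
    · simp [valueIter, h]
    · simp [valueIter, h]
  | succ k ih =>
    intro x
    simp only [valueIter]
    split_ifs with h
    · gcongr with x' _
      exact ih x'
    · exact le_rfl

theorem tendsto_valueIter (f : EuclideanSpace ℝ (Fin n) → EuclideanSpace ℝ (Fin m) →
    EuclideanSpace ℝ (Fin n)) (U : Set (EuclideanSpace ℝ (Fin m)))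
    (K C G : Set (EuclideanSpace ℝ (Fin n))) (l M ε d : ℝ) (x : EuclideanSpace ℝ (Fin n)) :
    Tendsto (fun k => valueIter f U K C G l M ε d k x) atTop
      (𝓝 (discreteMinimalTime f U K C G l M ε d x)) :=
  tendsto_atTop_iSup (monotone_nat_of_le_succ fun k => valueIter_le_succ f U K C G l M ε d k x)

end Discrete

end

/-! ### Continuous trajectories and their Euler steps. -/

section TrajectoryEstimates

variable {n m : ℕ} {f : EuclideanSpace ℝ (Fin n) → EuclideanSpace ℝ (Fin m) →
    EuclideanSpace ℝ (Fin n)} {U : Set (EuclideanSpace ℝ (Fin m))}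
  {K : Set (EuclideanSpace ℝ (Fin n))} {x₀ : EuclideanSpace ℝ (Fin n)} {t M : ℝ}
  {x : ℝ → EuclideanSpace ℝ (Fin n)} {u : ℝ → EuclideanSpace ℝ (Fin m)}

/-! The two inequalities have different sources. The upper bound holds for every `p`, without
epigraphic convergence. A trajectory reaching `C` at time `t` is sampled at multiples of `ε` and
rounded to the grid. Since `f y '' U` is closed and convex, the mean velocity of `f y (u ·)` over a
step is the velocity of a single control, and `ρ` absorbs the Euler and rounding errors, so the
samples form a chain of one-hop neighbours costing at most `t`
(`ReachesAt.exists_discreteMinimalTime_le`). Its first point lies within `d ≤ η` of `x`. The lower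
bound uses the upper Kuratowski limit: minimizers converge to `x` because `η → 0`, so minima
frequently at most `a` put `(x, a)` in the epigraph of the minimal time
(`le_of_frequently_le_of_kuratowskiLimsup_subset`). -/

theorem IsTrajectory.intervalIntegrable_of_mem (h : IsTrajectory f U x₀ t x u) {r s : ℝ}
    (hr : r ∈ Icc 0 t) (hs : s ∈ Icc 0 t) :
    IntervalIntegrable (fun a => f (x a) (u a)) volume r s := by
  refine h.integrable.mono_set ?_
  rw [uIcc_of_le (hr.1.trans hr.2)]
  exact uIcc_subset_Icc hr hs

theorem IsTrajectory.apply_sub_apply (h : IsTrajectory f U x₀ t x u) {r s : ℝ}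
    (hr : r ∈ Icc 0 t) (hs : s ∈ Icc 0 t) :
    x s - x r = ∫ a in r..s, f (x a) (u a) := by
  have h0 : (0 : ℝ) ∈ Icc 0 t := ⟨le_rfl, hr.1.trans hr.2⟩
  rw [h.eq_integral s hs, h.eq_integral r hr, add_sub_add_left_eq_sub,
    intervalIntegral.integral_interval_sub_left (h.intervalIntegrable_of_mem h0 hs)
      (h.intervalIntegrable_of_mem h0 hr)]

theorem IsTrajectory.apply_zero (h : IsTrajectory f U x₀ t x u) (ht : 0 ≤ t) : x 0 = x₀ := by
  simpa using h.eq_integral 0 ⟨le_rfl, ht⟩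

/-- A trajectory in `K` has speed at most `M`. -/
theorem IsTrajectory.norm_apply_sub_apply_le (h : IsTrajectory f U x₀ t x u)
    (hxK : ∀ s ∈ Icc 0 t, x s ∈ K) (hM : ∀ y ∈ K, ∀ v ∈ U, ‖f y v‖ ≤ M) {r s : ℝ}
    (hr : 0 ≤ r) (hrs : r ≤ s) (hs : s ≤ t) : ‖x s - x r‖ ≤ M * (s - r) := by
  rw [h.apply_sub_apply ⟨hr, hrs.trans hs⟩ ⟨hr.trans hrs, hs⟩]
  refine (intervalIntegral.norm_integral_le_of_norm_le_const fun a ha => ?_).trans_eq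
    (by rw [abs_of_nonneg (sub_nonneg.2 hrs)])
  rw [uIoc_of_le hrs] at ha
  have ha' : a ∈ Icc 0 t := ⟨hr.trans ha.1.le, ha.2.trans hs⟩
  exact hM _ (hxK a ha') _ (h.control_mem a ha')

/-- Continuity of `g` is known only on `U`; extending by `0` off the closed set `U` gives a Borel
function that agrees with `g` along the control. It serves for the velocity with frozen state. -/
theorem intervalIntegrable_comp_control {g : EuclideanSpace ℝ (Fin m) → EuclideanSpace ℝ (Fin n)}
    (hU : IsCompact U) (hg : ContinuousOn g U) (hgM : ∀ v ∈ U, ‖g v‖ ≤ M) (hu : Measurable u)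
    {r s : ℝ} (hrs : r ≤ s) (huU : ∀ a ∈ Ioc r s, u a ∈ U) :
    IntervalIntegrable (fun a => g (u a)) volume r s := by
  rw [intervalIntegrable_iff_integrableOn_Ioc_of_le hrs]
  classical
  have hmeas : Measurable (U.piecewise g (fun _ => 0)) :=
    hg.measurable_piecewise continuousOn_const hU.measurableSet
  have hae : AEStronglyMeasurable (fun a => g (u a)) (volume.restrict (Ioc r s)) := by
    refine (hmeas.comp hu).aestronglyMeasurable.congr ?_
    filter_upwards [ae_restrict_mem measurableSet_Ioc] with a ha
    simp [Set.piecewise_eq_of_mem _ _ _ (huU a ha)]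
  refine IntegrableOn.of_bound (by simp) hae M ?_
  filter_upwards [ae_restrict_mem measurableSet_Ioc] with a ha
  exact hgM _ (huU a ha)

/-- Over a time step of length `h`, a trajectory in `K` is an Euler step up to an error
`l M h²`. -/
theorem IsTrajectory.exists_euler_step {Ω : Set (EuclideanSpace ℝ (Fin n))} {l : ℝ≥0}
    (h : IsTrajectory f U x₀ t x u) (hU : IsCompact U) (hKΩ : K ⊆ Ω)
    (hf_cont : ∀ y ∈ Ω, ContinuousOn (f y) U)
    (hf_lip : ∀ v ∈ U, LipschitzOnWith l (fun y => f y v) Ω)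
    (hf_conv : ∀ y ∈ Ω, Convex ℝ (f y '' U))
    (hxK : ∀ s ∈ Icc 0 t, x s ∈ K) (hM : ∀ y ∈ K, ∀ v ∈ U, ‖f y v‖ ≤ M) (hM0 : 0 ≤ M)
    {r δ : ℝ} (hr : 0 ≤ r) (hδ : 0 < δ) (hrt : r + δ ≤ t) :
    ∃ v ∈ U, ‖x (r + δ) - x r - δ • f (x r) v‖ ≤ l * δ * (M * δ) := by
  have hle : r ≤ r + δ := by linarith
  have hrI : r ∈ Icc 0 t := ⟨hr, by linarith⟩
  have hmem : ∀ a ∈ Ioc r (r + δ), a ∈ Icc 0 t := fun a ha =>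
    ⟨hr.trans ha.1.le, ha.2.trans hrt⟩
  have hΩ : x r ∈ Ω := hKΩ (hxK r hrI)
  have hint : IntervalIntegrable (fun a => f (x r) (u a)) volume r (r + δ) :=
    intervalIntegrable_comp_control hU (hf_cont _ hΩ) (hM _ (hxK r hrI)) h.measurable_control hle
      fun a ha => h.control_mem a (hmem a ha)
  -- A closed convex set contains the averages of its integrable selections.
  have havg : (⨍ a in r..(r + δ), f (x r) (u a)) ∈ f (x r) '' U := by
    rw [uIoc_of_le hle]
    refine (hf_conv _ hΩ).set_average_mem (hU.image_of_continuousOn (hf_cont _ hΩ)).isClosed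
      (by simpa using hδ) (by simp) ?_
      ((intervalIntegrable_iff_integrableOn_Ioc_of_le hle).1 hint)
    filter_upwards [ae_restrict_mem measurableSet_Ioc] with a ha
    exact mem_image_of_mem _ (h.control_mem a (hmem a ha))
  obtain ⟨v, hv, hveq⟩ := havg
  refine ⟨v, hv, ?_⟩
  rw [interval_average_eq, add_sub_cancel_left] at hveq
  rw [hveq, smul_inv_smul₀ hδ.ne', h.apply_sub_apply hrI ⟨hr.trans hle, hrt⟩,
    ← intervalIntegral.integral_sub (h.intervalIntegrable_of_mem hrI ⟨hr.trans hle, hrt⟩) hint]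
  -- Only the drift of the state remains: it moves at most `M * δ`, which changes the velocity by at
  -- most `l * (M * δ)`.
  refine (intervalIntegral.norm_integral_le_of_norm_le_const (C := l * (M * δ))
    fun a ha => ?_).trans_eq ?_
  · rw [uIoc_of_le hle] at ha
    refine ((hf_lip _ (h.control_mem a (hmem a ha))).norm_sub_le
      (hKΩ (hxK a (hmem a ha))) hΩ).trans ?_
    gcongr
    refine (h.norm_apply_sub_apply_le hxK hM hr ha.1.le (hmem a ha).2).trans ?_
    gcongr
    linarith [ha.2]
  · rw [add_sub_cancel_left, abs_of_pos hδ]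
    ring

end TrajectoryEstimates

/-! ### Value iteration along chains of grid points. -/

section DiscreteEstimates

variable {n m : ℕ} {f : EuclideanSpace ℝ (Fin n) → EuclideanSpace ℝ (Fin m) →
    EuclideanSpace ℝ (Fin n)} {U : Set (EuclideanSpace ℝ (Fin m))}
  {K C G : Set (EuclideanSpace ℝ (Fin n))} {M ε d t : ℝ}

theorem mem_gridSet_of_dist_le {x y : EuclideanSpace ℝ (Fin n)} (hx : x ∈ K) (hy : y ∈ G)
    (hxy : dist x y ≤ d) : y ∈ gridSet K G d :=
  ⟨⟨x, hx, y - x, by rwa [mem_closedBall_zero_iff, ← dist_eq_norm, dist_comm], by simp⟩, hy⟩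

/-- A chain of `N` one-hop neighbours that ends in the terminal set bounds the discrete minimal
time of its initial point. -/
theorem discreteMinimalTime_le_of_chain {l : ℝ} {N : ℕ} (y : ℕ → EuclideanSpace ℝ (Fin n))
    (hy : ∀ j ≤ N, y j ∈ gridSet K G d)
    (hstep : ∀ j < N, y (j + 1) ∈ oneHop f U K G l M ε d (y j))
    (hend : y N ∈ C + Metric.closedBall 0 (M * ε + d)) :
    discreteMinimalTime f U K C G l M ε d (y 0) ≤ N * ENNReal.ofReal (ε - d) := by
  -- The bound counts the hops left after `y j`. It must hold for all `j` at once, as iterate `k +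
  -- 1` at `y j` calls iterate `k` at `y (j + 1)`.
  have key : ∀ k, ∀ j ≤ N, valueIter f U K C G l M ε d k (y j) ≤
      ((N - j : ℕ) : ℝ≥0∞) * ENNReal.ofReal (ε - d) := by
    intro k
    induction k with
    | zero =>
      intro j hj
      simp [valueIter, hy j hj]
    | succ k ih =>
      intro j hj
      simp only [valueIter]
      split_ifs with hmem
      · have hjN : j < N := lt_of_le_of_ne hj fun hjN => hmem.2 (hjN ▸ hend)
        have hsub : N - j = (N - (j + 1)) + 1 := by omega
        rw [hsub, Nat.cast_add, Nat.cast_one, add_mul, one_mul, add_comm]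
        gcongr
        exact (iInf₂_le _ (hstep j hjN)).trans (ih _ hjN)
      · exact ih j hj
  exact iSup_le fun k => key k 0 (Nat.zero_le N)

/-- If `C` can be reached from `x` at time `t`, then the discrete minimal time is at most `t` at
some grid point within `d` of `x`. -/
theorem ReachesAt.exists_discreteMinimalTime_le {Ω : Set (EuclideanSpace ℝ (Fin n))} {l : ℝ≥0}
    {x₀ : EuclideanSpace ℝ (Fin n)} (h : ReachesAt f U K C x₀ t)
    (hU : IsCompact U) (hKΩ : K ⊆ Ω)
    (hf_cont : ∀ y ∈ Ω, ContinuousOn (f y) U)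
    (hf_lip : ∀ v ∈ U, LipschitzOnWith l (fun y => f y v) Ω)
    (hf_conv : ∀ y ∈ Ω, Convex ℝ (f y '' U))
    (hM : ∀ y ∈ K, ∀ v ∈ U, ‖f y v‖ ≤ M) (hM0 : 0 ≤ M) (hd : 0 < d) (hdε : d < ε) (hGΩ : G ⊆ Ω)
    (hG_cover : ∀ y ∈ K, ∃ z ∈ G, dist y z ≤ d) :
    ∃ z ∈ gridSet K G d, dist x₀ z ≤ d ∧
      discreteMinimalTime f U K C G l M ε d z ≤ ENNReal.ofReal t := by
  obtain ⟨ht, x, u, htraj, hxC, hxK⟩ := h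
  have hε : 0 < ε := hd.trans hdε
  set N : ℕ := ⌊t / ε⌋₊ with hN
  have hNt : N * ε ≤ t := by
    rw [← le_div_iff₀ hε]
    exact Nat.floor_le (by positivity)
  have htN : t < (N + 1) * ε := by
    rw [← div_lt_iff₀ hε]
    exact Nat.lt_floor_add_one _
  have hI : ∀ j ≤ N, (j : ℝ) * ε ∈ Icc 0 t := fun j hj =>
    ⟨by positivity, le_trans (by gcongr) hNt⟩
  have hgrid : ∀ j : ℕ, ∃ z, j ≤ N → z ∈ G ∧ dist (x (j * ε)) z ≤ d := fun j => by
    by_cases hj : j ≤ N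
    · obtain ⟨z, hz⟩ := hG_cover _ (hxK _ (hI j hj))
      exact ⟨z, fun _ => hz⟩
    · exact ⟨0, fun h => absurd h hj⟩
  choose y hy using hgrid
  have hyK : ∀ j ≤ N, y j ∈ gridSet K G d := fun j hj =>
    mem_gridSet_of_dist_le (hxK _ (hI j hj)) (hy j hj).1 (hy j hj).2
  refine ⟨y 0, hyK 0 (Nat.zero_le N), ?_, ?_⟩
  · simpa [htraj.apply_zero ht] using (hy 0 (Nat.zero_le N)).2
  refine (discreteMinimalTime_le_of_chain y hyK (fun j hj => ⟨?_, hyK _ hj⟩) ?_).trans ?_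
  · have hj1 := hI (j + 1) hj
    rw [Nat.cast_add, Nat.cast_one, add_mul, one_mul] at hj1
    obtain ⟨v, hv, hstep⟩ := htraj.exists_euler_step hU hKΩ hf_cont hf_lip hf_conv hxK hM hM0
      (hI j hj.le).1 hε hj1.2
    refine ⟨y j + ε • f (y j) v, add_mem_add rfl (smul_mem_smul_set (mem_image_of_mem _ hv)),
      y (j + 1) - (y j + ε • f (y j) v), ?_, by simp⟩
    rw [mem_closedBall_zero_iff]
    have h1 := (hy j hj.le).2
    have h2 := (hy (j + 1) hj).2
    rw [Nat.cast_add, Nat.cast_one, add_mul, one_mul, dist_comm, dist_eq_norm] at h2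
    have h3 : ‖ε • (f (x (j * ε)) v - f (y j) v)‖ ≤ ε * (l * d) := by
      rw [norm_smul, Real.norm_of_nonneg hε.le]
      gcongr
      refine ((hf_lip v hv).norm_sub_le (hKΩ (hxK _ (hI j hj.le))) (hGΩ (hy j hj.le).1)).trans ?_
      gcongr
      rwa [← dist_eq_norm]
    rw [dist_eq_norm] at h1
    -- Two roundings (`d` each), the Euler error `l M ε²` and the velocity change `l ε d` add up to
    -- exactly `ρ`.
    have hsplit : y (j + 1) - (y j + ε • f (y j) v) =
        (y (j + 1) - x (j * ε + ε)) + (x (j * ε + ε) - x (j * ε) - ε • f (x (j * ε)) v) +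
          (x (j * ε) - y j) + ε • (f (x (j * ε)) v - f (y j) v) := by
      rw [smul_sub]
      abel
    rw [hsplit, perturbRadius]
    refine (norm_add₄_le).trans ?_
    linarith
  -- The leftover time `t - N ε` is below `ε`, so the last sample is within `M ε` of `x t ∈ C`, and
  -- rounding adds `d`.
  · refine ⟨x t, hxC, y N - x t, ?_, by simp⟩
    rw [mem_closedBall_zero_iff]
    have h1 := (hy N le_rfl).2
    rw [dist_comm, dist_eq_norm] at h1
    have h2 : ‖x (N * ε) - x t‖ ≤ M * ε := by
      rw [norm_sub_rev]
      refine (htraj.norm_apply_sub_apply_le hxK hM (hI N le_rfl).1 hNt le_rfl).trans ?_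
      gcongr
      linarith
    linarith [norm_sub_le_norm_sub_add_norm_sub (y N) (x (N * ε)) (x t)]
  · rw [← ENNReal.ofReal_natCast, ← ENNReal.ofReal_mul (Nat.cast_nonneg _)]
    refine ENNReal.ofReal_le_ofReal (le_trans ?_ hNt)
    gcongr
    linarith

end DiscreteEstimates

/-! ### Epigraphic limits and the main theorem. -/

theorem mem_epigraph_nnreal {E : Type*} {φ : E → ℝ≥0∞} {x : E} {a : ℝ≥0} :
    (x, (a : ℝ)) ∈ epigraph φ ↔ φ x ≤ a := by
  rw [← EReal.coe_ennreal_le_coe_ennreal_iff, EReal.coe_nnreal_eq_coe_real]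
  rfl

/-- Frequent upper bounds along a convergent sequence of points pass to a function whose epigraph
contains the upper Kuratowski limit of the epigraphs. -/
theorem le_of_frequently_le_of_kuratowskiLimsup_subset {E : Type*} [PseudoEMetricSpace E]
    {φ : ℕ → E → ℝ≥0∞} {ψ : E → ℝ≥0∞}
    (h : kuratowskiLimsup (fun p => epigraph (φ p)) ⊆ epigraph ψ) {z : ℕ → E} {x : E}
    (hz : Tendsto z atTop (𝓝 x)) {a : ℝ≥0} (ha : ∃ᶠ p in atTop, φ p (z p) ≤ a) : ψ x ≤ a := by
  have hmem : (x, (a : ℝ)) ∈ kuratowskiLimsup (fun p => epigraph (φ p)) := by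
    refine le_antisymm (le_of_forall_gt fun c hc => ?_) bot_le
    obtain ⟨b, hb, hbc⟩ := exists_between hc
    refine lt_of_le_of_lt (liminf_le_of_frequently_le' ?_) hbc
    refine (ha.and_eventually (hz (Metric.eball_mem_nhds x hb))).mono fun p hp => ?_
    refine (Metric.infEDist_le_edist_of_mem (mem_epigraph_nnreal.2 hp.1)).trans ?_
    have h2 : edist (z p) x < b := hp.2
    rw [Prod.edist_eq, edist_self, edist_comm]
    simpa using h2.le
  exact mem_epigraph_nnreal.1 (h hmem)

theorem mainTheorem3 {n m : ℕ}
    -- the control system `x' = f (x, u)`, given for states in `Ω` and controls in `U`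
    (f : EuclideanSpace ℝ (Fin n) → EuclideanSpace ℝ (Fin m) → EuclideanSpace ℝ (Fin n))
    (Ω : Set (EuclideanSpace ℝ (Fin n))) (U : Set (EuclideanSpace ℝ (Fin m)))
    (K C : Set (EuclideanSpace ℝ (Fin n))) (l : ℝ≥0) (M : ℝ)
    (hU : IsCompact U) (hU_ne : U.Nonempty)
    (hK : IsCompact K) (hK_ne : K.Nonempty) (hKΩ : K ⊆ Ω)
    (hC : IsClosed C) (hCK : C ⊆ K)
    (hf_cont : ∀ x ∈ Ω, ContinuousOn (f x) U)
    (hf_lip : ∀ u ∈ U, LipschitzOnWith l (fun x => f x u) Ω)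
    (hf_conv : ∀ x ∈ Ω, Convex ℝ (f x '' U))
    (hM : IsGreatest {r : ℝ | ∃ x ∈ K, ∃ u ∈ U, r = ‖f x u‖} M)
    -- the resolutions and the grids
    (ε d : ℕ → ℝ) (G : ℕ → Set (EuclideanSpace ℝ (Fin n)))
    (hd_pos : ∀ p, 0 < d p) (hdε : ∀ p, d p < ε p)
    (hε : Tendsto ε atTop (𝓝 0)) (hdε_lim : Tendsto (fun p => d p / ε p) atTop (𝓝 0))
    (hGΩ : ∀ p, G p ⊆ Ω)
    (hG_cover : ∀ p, ∀ x ∈ K, ∃ y ∈ G p, dist x y ≤ d p)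
    (hG_fin : ∀ p, (gridSet K (G p) (d p)).Finite)
    -- the perturbation radii
    (η : ℕ → ℝ) (hdη : ∀ p, d p ≤ η p)
    (hη_lim : ∃ L : ℝ, 1 ≤ L ∧ Tendsto (fun p => η p / d p) atTop (𝓝 L))
    -- epigraphic convergence
    (hepi : IsKuratowskiLimit
      (fun p => epigraph (discreteMinimalTime f U K C (G p) l M (ε p) (d p)))
      (epigraph (minimalTime f U K C))) :
    ∀ x ∈ K, minimalTime f U K C x < ⊤ →
      ∃ μ : ℕ → ℝ≥0∞,
        (∀ p, IsLeast (discreteMinimalTime f U K C (G p) l M (ε p) (d p) ''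
          (Metric.closedBall x (η p) ∩ gridSet K (G p) (d p))) (μ p)) ∧
        Tendsto μ atTop (𝓝 (minimalTime f U K C x)) := by
  intro x hx hxT
  have hMb : ∀ y ∈ K, ∀ v ∈ U, ‖f y v‖ ≤ M := fun y hy v hv => hM.2 ⟨y, hy, v, hv, rfl⟩
  have hM0 : 0 ≤ M := by
    obtain ⟨y, -, v, -, rfl⟩ := hM.1
    exact norm_nonneg _
  have hd_lim : Tendsto d atTop (𝓝 0) :=
    squeeze_zero (fun p => (hd_pos p).le) (fun p => (hdε p).le) hε
  have hη : Tendsto η atTop (𝓝 0) := by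
    obtain ⟨L, -, hL⟩ := hη_lim
    have := hL.mul hd_lim
    rw [mul_zero] at this
    exact this.congr fun p => div_mul_cancel₀ _ (hd_pos p).ne'
  have hmin : ∀ p, ∃ z ∈ Metric.closedBall x (η p) ∩ gridSet K (G p) (d p),
      ∀ z' ∈ Metric.closedBall x (η p) ∩ gridSet K (G p) (d p),
        discreteMinimalTime f U K C (G p) l M (ε p) (d p) z ≤
          discreteMinimalTime f U K C (G p) l M (ε p) (d p) z' := by
    intro p
    obtain ⟨z, hz, hxz⟩ := hG_cover p x hx
    refine Set.exists_min_image _ _ ((hG_fin p).subset inter_subset_right) ⟨z, ?_, ?_⟩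
    · rw [Metric.mem_closedBall, dist_comm]
      exact hxz.trans (hdη p)
    · exact mem_gridSet_of_dist_le hx hz hxz
  choose z hz hzmin using hmin
  refine ⟨fun p => discreteMinimalTime f U K C (G p) l M (ε p) (d p) (z p),
    fun p => ⟨mem_image_of_mem _ (hz p), forall_mem_image.2 (hzmin p)⟩, ?_⟩
  have hzx : Tendsto z atTop (𝓝 x) :=
    tendsto_iff_dist_tendsto_zero.2 (squeeze_zero (fun _ => dist_nonneg) (fun p => (hz p).1) hη)
  refine tendsto_order.2 ⟨fun a ha => ?_, fun b hb => ?_⟩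
  · by_contra hcon
    -- Epigraphs have only real heights; `a` is finite because the minimal time at `x` is.
    lift a to ℝ≥0 using (ha.trans hxT).ne
    refine ha.not_ge (le_of_frequently_le_of_kuratowskiLimsup_subset hepi.2.le hzx ?_)
    exact (not_eventually.1 hcon).mono fun p hp => not_lt.1 hp
  · obtain ⟨t, ht⟩ := iInf_lt_iff.1 hb
    obtain ⟨hreach, ht⟩ := iInf_lt_iff.1 ht
    -- Some reaching time `t` lies below `b`, and it bounds the minimum for every `p`.
    refine Eventually.of_forall fun p => lt_of_le_of_lt ?_ ht
    obtain ⟨z', hz', hxz', hle⟩ := hreach.exists_discreteMinimalTime_le hU hKΩ hf_cont hf_lip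
      hf_conv hMb hM0 (hd_pos p) (hdε p) (hGΩ p) (hG_cover p)
    refine (hzmin p z' ⟨?_, hz'⟩).trans hle
    rw [Metric.mem_closedBall, dist_comm]
    exact hxz'.trans (hdη p)
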